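/- Let $G$ be a finite, undirected, simple graph. Write $\alpha(G)$ for its independence number and $i(G,x)=\sum_{j=0}^{\alpha(G)} i_j x^j$ for its independence polynomial, where $i_j$ is the number of independent vertex sets of $G$ of size $j$. Call a graph stable if every complex root $z$ of its independence polynomial satisfies $\operatorname{Re}(z)\le 0$. Let $G^{*}$ denote the graph obtained from $G$ by attaching one new pendant vertex to each vertex of $G$ (the corona of $G$ with $K_1$), and put $G^{1*}=G^{*}$ and $G^{k*}=(G^{(k-1)*})^{*}$ for $k\ge 2$. If $G$ is claw-free (that is, $G$ has no induced subgraph isomorphic to $K_{1,3}$), or $G$ is a star $K_{1,n}$, or $\alpha(G)\le 3$, then $G^{k*}$ is stable for every integer $k\ge 1$. -/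

import Mathlib

open Polynomial

namespace IndepStability

universe u v

/-- The independence polynomial `i(G, x) = ∑_{k=0}^{α(G)} i_k x^k` of a finite graph `G`, where `i_k`
is the number of independent vertex sets of size `k` and `α(G)` is the independence number. -/
noncomputable def indepPoly {V : Type u} (G : SimpleGraph V) : ℝ[X] :=
  ∑ k ∈ Finset.range (G.indepNum + 1),
    Polynomial.monomial k ((Set.ncard {s : Finset V | G.IsNIndepSet k s} : ℕ) : ℝ)

/-- A real polynomial is (Hurwitz quasi-)stable if all its complex roots lie in the closed left
half-plane `{z : Re z ≤ 0}`. -/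
def PolyStable (p : ℝ[X]) : Prop :=
  ∀ z : ℂ, Polynomial.aeval z p = 0 → z.re ≤ 0

/-- A graph is stable if its independence polynomial is stable. -/
def GraphStable {V : Type u} (G : SimpleGraph V) : Prop :=
  PolyStable (indepPoly G)

/-- A graph is claw-free if it has no induced subgraph isomorphic to `K_{1,3}`. -/
def ClawFree {V : Type u} (G : SimpleGraph V) : Prop :=
  ¬ (completeBipartiteGraph (Fin 1) (Fin 3)).IsIndContained G

/-- Adjacency in the corona: `Sum.inl v` is the vertex `v` of `G`, and `Sum.inr (v, w)` is the
vertex `w` of the copy of `H` attached to `v`. -/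
def coronaAdj {V : Type u} {W : Type v} (G : SimpleGraph V) (H : SimpleGraph W) :
    V ⊕ V × W → V ⊕ V × W → Prop
  | Sum.inl a, Sum.inl b => G.Adj a b
  | Sum.inl a, Sum.inr (b, _) => a = b
  | Sum.inr (a, _), Sum.inl b => a = b
  | Sum.inr (a, w), Sum.inr (b, w') => a = b ∧ H.Adj w w'

/-- The corona `G ∘ H`: start with `G` and, for each vertex `v` of `G`, join a new copy of `H`
to `v`. -/
def corona {V : Type u} {W : Type v} (G : SimpleGraph V) (H : SimpleGraph W) :
    SimpleGraph (V ⊕ V × W) where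
  Adj := coronaAdj G H
  symm := ⟨by
    rintro (a | ⟨a, w⟩) (b | ⟨b, w'⟩) h
    · exact SimpleGraph.Adj.symm h
    · exact Eq.symm h
    · exact Eq.symm h
    · exact ⟨h.1.symm, SimpleGraph.Adj.symm h.2⟩⟩
  loopless := ⟨by
    rintro (a | ⟨a, w⟩) h
    · exact G.irrefl h
    · exact H.irrefl h.2⟩

/-- The graph star `G^* = G ∘ K_1`. -/
def graphStar {V : Type u} (G : SimpleGraph V) : SimpleGraph (V ⊕ V × Unit) :=
  corona G (⊤ : SimpleGraph Unit)

/-- The vertex type of the graph `k`-star. -/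
def KStarVertex (V : Type u) : ℕ → Type u
  | 0 => V
  | k + 1 => KStarVertex V k ⊕ KStarVertex V k × Unit

/-- The graph `k`-star `G^{k*}`: the graph star iterated `k` times. In particular `G^{1*} = G^*` and
`G^{k*} = (G^{(k-1)*})^*` for `k ≥ 2`. -/
def kStar {V : Type u} (G : SimpleGraph V) : (k : ℕ) → SimpleGraph (KStarVertex V k)
  | 0 => G
  | k + 1 => graphStar (kStar G k)

end IndepStability

namespace IndepStability

universe u

/-! The corona identity i(G*, z) = (1+z)^n i(G, z/(1+z)) is a translation in the coordinate 1/z: for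
w = z/(1+z), 1/w = 1/z + 1. So G* has no zero with Re z > 0 as soon as G has none with Re(1/z) > 1.
The second region lies inside the first, so the condition passes from G to G* and only G has to be
checked (`graphStable_kStar`).

On that region Re z > 0 and |z| < 1. For a star, |1+z|^n ≥ 1 > |z|. For α ≤ 3, Routh–Hurwitz applies
to a cubic in 1/z - 1. For claw-free G, expand |i(G,z)|² over pairs (A, B) of independent sets and
group them by A ∩ B and A ∪ B. Each nonempty group is a power of |z|² times a product over the
connected components of the bipartite graph on the symmetric difference. Claw-freeness keeps the two
colour classes of a component within one of each other in size, so each factor is nonnegative for Re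
z ≥ 0. The pair (∅, ∅) contributes 1, hence |i(G,z)|² ≥ 1. -/

open Classical in
/-- The independence polynomial evaluated at `z`, as a sum over the independent sets. -/
noncomputable def indepSum {V : Type*} [Fintype V] (G : SimpleGraph V) (z : ℂ) : ℂ :=
  ∑ s ∈ Finset.univ.filter (fun s : Finset V => G.IsIndepSet (s : Set V)), z ^ s.card

lemma aeval_indepPoly {V : Type*} [Fintype V] (G : SimpleGraph V) (z : ℂ) :
    aeval z (indepPoly G) = indepSum G z := by
  classical
  have hmap : ∀ s ∈ (Finset.univ.filter fun s : Finset V => G.IsIndepSet (s : Set V)),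
      s.card ∈ Finset.range (G.indepNum + 1) := by
    intro s hs
    have := (Finset.mem_filter.1 hs).2.card_le_indepNum
    simpa [Nat.lt_succ_iff] using this
  rw [indepSum, ← Finset.sum_fiberwise_of_maps_to hmap, indepPoly, map_sum]
  refine Finset.sum_congr rfl fun k _ => ?_
  have h : {s : Finset V | G.IsNIndepSet k s} =
      ((Finset.univ.filter fun s : Finset V => G.IsIndepSet (s : Set V)).filter
        fun s => s.card = k : Finset (Finset V)) := by
    ext s
    simp [SimpleGraph.isNIndepSet_iff]
  rw [h, Set.ncard_coe_finset, aeval_monomial,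
    Finset.sum_congr rfl fun s hs => by rw [(Finset.mem_filter.1 hs).2]]
  simp

/-! ### Coronas and the reduction to G -/

lemma isIndepSet_graphStar {V : Type u} (G : SimpleGraph V) (s : Finset V)
    (t : Finset (V × Unit)) :
    (graphStar G).IsIndepSet (s.disjSum t : Set (V ⊕ V × Unit)) ↔
      G.IsIndepSet (s : Set V) ∧ ∀ v ∈ s, (v, ()) ∉ t := by
  constructor
  · intro h
    refine ⟨fun a ha b hb hab => ?_, fun v hv hvt => ?_⟩
    · exact h (x := .inl a) (by simpa using ha) (y := .inl b) (by simpa using hb) (by simpa using hab)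
    · exact h (x := .inl v) (by simpa using hv) (y := .inr (v, ())) (by simpa using hvt)
        (by simp) rfl
  · rintro ⟨h, h'⟩ (a | ⟨a, ⟨⟩⟩) ha (b | ⟨b, ⟨⟩⟩) hb hab hadj
    · exact h (by simpa using ha) (by simpa using hb) (by simpa using hab) hadj
    · obtain rfl : a = b := hadj
      exact h' a (by simpa using ha) (by simpa using hb)
    · obtain rfl : a = b := hadj
      exact h' a (by simpa using hb) (by simpa using ha)
    · exact hadj.2.ne rfl

open Classical in
lemma indepSum_sum {V W : Type*} [Fintype V] [Fintype W] (G : SimpleGraph (V ⊕ W)) (z : ℂ) :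
    indepSum G z = ∑ s : Finset V, ∑ t : Finset W,
      if G.IsIndepSet (s.disjSum t : Set (V ⊕ W)) then z ^ s.card * z ^ t.card else 0 := by
  rw [indepSum, Finset.sum_filter, ← Fintype.sum_prod_type']
  refine (Fintype.sum_equiv Finset.sumEquiv.symm.toEquiv _ _ ?_).symm
  rintro ⟨s, t⟩
  have h : Finset.sumEquiv.symm.toEquiv (s, t) = s.disjSum t := rfl
  rw [h, Finset.card_disjSum, pow_add]
  by_cases hs : G.IsIndepSet (s.disjSum t : Set (V ⊕ W))
  · rw [if_pos hs, if_pos hs]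
  · rw [if_neg hs, if_neg hs]

/-- Over a fixed independent s, the leaves may be chosen freely among those not attached to s, which
contributes (1+z)^(n-|s|). -/
lemma indepSum_graphStar {V : Type u} [Fintype V] (G : SimpleGraph V) {z : ℂ} (hz : 1 + z ≠ 0) :
    indepSum (graphStar G) z = (1 + z) ^ Fintype.card V * indepSum G (z / (1 + z)) := by
  classical
  rw [indepSum_sum, indepSum, Finset.mul_sum, Finset.sum_filter]
  refine Finset.sum_congr rfl fun s _ => ?_
  rw [← Equiv.sum_comp (Equiv.prodUnique V Unit).symm.finsetCongr]
  have key : ∀ t : Finset V, (graphStar G).IsIndepSet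
      (s.disjSum ((Equiv.prodUnique V Unit).symm.finsetCongr t) : Set (V ⊕ V × Unit)) ↔
      G.IsIndepSet (s : Set V) ∧ t ⊆ sᶜ := by
    intro t
    rw [isIndepSet_graphStar]
    refine and_congr_right fun _ => ?_
    simp only [Equiv.finsetCongr_apply, Finset.mem_map, Finset.subset_iff, Finset.mem_compl]
    constructor
    · intro h x hx hxs
      exact h x hxs ⟨x, hx, rfl⟩
    · rintro h v hv ⟨x, hx, hxv⟩
      obtain rfl : x = v := congrArg Prod.fst hxv
      exact h hx hv
  have hcard : ∀ t : Finset V, ((Equiv.prodUnique V Unit).symm.finsetCongr t).card = t.card :=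
    fun t => by rw [Equiv.finsetCongr_apply, Finset.card_map]
  simp only [key, hcard]
  by_cases hs : G.IsIndepSet (s : Set V)
  · simp only [hs, true_and, if_true]
    rw [← Finset.sum_filter, ← Finset.mul_sum]
    have h1 : (Finset.univ.filter fun t : Finset V => t ⊆ sᶜ) = sᶜ.powerset := by
      ext t; simp
    have h2 := Finset.sum_pow_mul_eq_add_pow z 1 sᶜ
    simp only [one_pow, mul_one] at h2
    rw [h1, h2, ← Finset.card_add_card_compl s, pow_add, div_pow, add_comm z 1]
    field_simp
  · simp [hs]

/-- If `i(G, z) ≠ 0` whenever `Re (1 / z) > 1`, then all the iterated stars of `G` are stable. -/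
lemma graphStable_kStar {V : Type u} [Finite V] (G : SimpleGraph V)
    (h : ∀ z : ℂ, 1 < (z⁻¹).re → aeval z (indepPoly G) ≠ 0) (k : ℕ) (hk : 1 ≤ k) :
    GraphStable (kStar G k) := by
  have hfin : ∀ k, Finite (KStarVertex V k) := by
    intro k
    induction k with
    | zero => assumption
    | succ k ih => exact inferInstanceAs (Finite (KStarVertex V k ⊕ KStarVertex V k × Unit))
  have step : ∀ k, (∀ z : ℂ, 1 < (z⁻¹).re → aeval z (indepPoly (kStar G k)) ≠ 0) →
      ∀ z : ℂ, 0 < z.re → aeval z (indepPoly (kStar G (k + 1))) ≠ 0 := by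
    intro k ih z hz
    have := hfin k
    have := Fintype.ofFinite (KStarVertex V k)
    have hz1 : 1 + z ≠ 0 := fun h0 => by
      have := congrArg Complex.re h0
      simp at this; linarith
    have hz0 : z ≠ 0 := fun h0 => by simp [h0] at hz
    have hre : 0 < (z⁻¹).re := by
      rw [Complex.inv_re]; exact div_pos hz (Complex.normSq_pos.2 hz0)
    have := ih (z / (1 + z)) (by
      rw [inv_div, add_div, div_self hz0, one_div, Complex.add_re, Complex.one_re]; linarith)
    rw [aeval_indepPoly] at this
    change aeval z (indepPoly (graphStar (kStar G k))) ≠ 0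
    rw [aeval_indepPoly, indepSum_graphStar _ hz1]
    exact mul_ne_zero (pow_ne_zero _ hz1) this
  have all : ∀ k, ∀ z : ℂ, 1 < (z⁻¹).re → aeval z (indepPoly (kStar G k)) ≠ 0 := by
    intro k
    induction k with
    | zero => exact h
    | succ k ih =>
      refine fun z hz => step k ih z ?_
      have hz0 : z ≠ 0 := fun h0 => by simp [h0] at hz; linarith
      rw [Complex.inv_re] at hz
      by_contra hc
      exact absurd (div_nonpos_of_nonpos_of_nonneg (not_lt.1 hc) (Complex.normSq_nonneg z))
        (by linarith)
  obtain ⟨k, rfl⟩ := Nat.exists_eq_add_of_le' hk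
  exact fun z h0 => not_lt.1 fun hz => step k (all k) z hz h0

/-- A complex number with `Re (1 / z) > 1` lies in the right half-plane and in the unit disc. -/
lemma re_pos_and_norm_lt_one {z : ℂ} (hz : 1 < (z⁻¹).re) : 0 < z.re ∧ ‖z‖ < 1 := by
  have hz0 : z ≠ 0 := fun h0 => by simp [h0] at hz; linarith
  have hn := Complex.normSq_pos.2 hz0
  have hlt : Complex.normSq z < z.re := by
    rwa [Complex.inv_re, one_lt_div hn] at hz
  refine ⟨hn.trans hlt, ?_⟩
  have h1 : 1 < ‖z⁻¹‖ := hz.trans_le (Complex.re_le_norm _)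
  rw [norm_inv] at h1
  exact (one_lt_inv₀ (norm_pos_iff.2 hz0)).1 h1

/-! ### Stars -/

lemma indepSum_congr {V W : Type*} [Fintype V] [Fintype W] {G : SimpleGraph V}
    {H : SimpleGraph W} (e : G ≃g H) (z : ℂ) : indepSum G z = indepSum H z := by
  classical
  rw [indepSum, indepSum, Finset.sum_filter, Finset.sum_filter]
  refine Fintype.sum_equiv e.toEquiv.finsetCongr _ _ fun s => ?_
  have : G.IsIndepSet (s : Set V) ↔ H.IsIndepSet (e.toEquiv.finsetCongr s : Set W) := by
    simp only [SimpleGraph.isIndepSet_iff, Equiv.finsetCongr_apply, Finset.coe_map,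
      Set.Pairwise, Set.forall_mem_image, Equiv.coe_toEmbedding]
    simp [e.map_adj_iff]
  simp only [this, Equiv.finsetCongr_apply, Finset.card_map]

lemma indepSum_star (n : ℕ) (z : ℂ) :
    indepSum (completeBipartiteGraph (Fin 1) (Fin n)) z = z + (1 + z) ^ n := by
  classical
  rw [indepSum_sum]
  have key : ∀ (s : Finset (Fin 1)) (t : Finset (Fin n)),
      (completeBipartiteGraph (Fin 1) (Fin n)).IsIndepSet
        ((s.disjSum t : Finset (Fin 1 ⊕ Fin n)) : Set (Fin 1 ⊕ Fin n)) ↔ s = ∅ ∨ t = ∅ := by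
    intro s t
    constructor
    · intro h
      by_contra! hc
      obtain ⟨⟨a, ha⟩, b, hb⟩ := hc
      exact h (x := .inl a) (by simpa using ha) (y := .inr b) (by simpa using hb) (by simp)
        (by simp)
    · rintro (rfl | rfl) (a | a) ha (b | b) hb hab <;> simp_all
  have hu : (Finset.univ : Finset (Finset (Fin 1))) = {∅, {0}} := by decide
  simp only [key, hu]
  rw [Finset.sum_pair (by decide)]
  have h2 := Fintype.sum_pow_mul_eq_add_pow (Fin n) z 1
  simp only [one_pow, mul_one, Fintype.card_fin] at h2
  simp [h2, add_comm]

lemma indepSum_star_ne_zero (n : ℕ) {z : ℂ} (hz : 1 < (z⁻¹).re) :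
    indepSum (completeBipartiteGraph (Fin 1) (Fin n)) z ≠ 0 := by
  obtain ⟨hre, hnorm⟩ := re_pos_and_norm_lt_one hz
  rw [indepSum_star]
  intro h
  have h1 : 1 ≤ ‖1 + z‖ := by
    have := Complex.re_le_norm (1 + z)
    simp at this; linarith
  have h2 : 1 ≤ ‖(1 + z) ^ n‖ := by rw [norm_pow]; exact one_le_pow₀ h1
  rw [eq_neg_of_add_eq_zero_right h, norm_neg] at h2
  linarith

/-! ### Independence number at most three -/

/-- The Routh–Hurwitz criterion for cubics, for roots in the open right half-plane. -/
lemma cubic_ne_zero {a b c : ℝ} (ha : 0 < a) (hb : 0 < b) (hc : 0 < c) (h : c ≤ a * b) {s : ℂ}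
    (hs : 0 < s.re) : s ^ 3 + a * s ^ 2 + b * s + c ≠ 0 := by
  obtain ⟨x, y⟩ := s
  change 0 < x at hs
  intro h0
  have hre := congrArg Complex.re h0
  have him := congrArg Complex.im h0
  simp [pow_succ] at hre him
  have hre' : x ^ 3 - 3 * x * y ^ 2 + a * (x ^ 2 - y ^ 2) + b * x + c = 0 := by linarith
  have him' : y * (3 * x ^ 2 - y ^ 2 + 2 * a * x + b) = 0 := by linarith
  rcases mul_eq_zero.1 him' with rfl | hy
  · have : 0 < x ^ 3 + a * x ^ 2 + b * x + c := by positivity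
    nlinarith
  -- Eliminating y² turns the real part into -(8x³ + 8ax² + 2(a²+b)x) - (ab - c), which is negative.
  · have hy2 : y ^ 2 = 3 * x ^ 2 + 2 * a * x + b := by linarith
    rw [hy2] at hre'
    have : 0 < 8 * x ^ 3 + 8 * a * x ^ 2 + 2 * (a ^ 2 + b) * x := by positivity
    nlinarith

open Classical in
/-- The number of independent sets of size `k`. -/
noncomputable def indepCount {V : Type*} [Fintype V] (G : SimpleGraph V) (k : ℕ) : ℕ :=
  (Finset.univ.filter fun s : Finset V => G.IsNIndepSet k s).card

/-- Every independent (k+1)-set is a vertex inserted into an independent k-set. The case k = 2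
supplies the Routh–Hurwitz inequality. -/
lemma indepCount_succ_le {V : Type*} [Fintype V] (G : SimpleGraph V) (k : ℕ) :
    indepCount G (k + 1) ≤ Fintype.card V * indepCount G k := by
  classical
  rw [indepCount, indepCount, ← Finset.card_univ, ← Finset.card_product]
  refine le_trans (Finset.card_le_card ?_)
    (Finset.card_image_le (f := fun p : V × Finset V => insert p.1 p.2))
  intro s hs
  obtain ⟨hs, hcard⟩ := (Finset.mem_filter.1 hs).2
  obtain ⟨a, ha⟩ : s.Nonempty := Finset.card_pos.1 (by omega)
  refine Finset.mem_image.2 ⟨(a, s.erase a), ?_, Finset.insert_erase ha⟩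
  simp only [Finset.mem_product, Finset.mem_univ, true_and, Finset.mem_filter]
  exact ⟨hs.mono (by simp), by rw [Finset.card_erase_of_mem ha, hcard]; rfl⟩

lemma indepCount_one {V : Type*} [Fintype V] (G : SimpleGraph V) :
    indepCount G 1 = Fintype.card V := by
  classical
  rw [indepCount, ← Finset.card_univ, ← Finset.card_image_of_injective _
    (Finset.singleton_injective (α := V))]
  congr 1
  ext s
  simp only [Finset.mem_filter, Finset.mem_univ, true_and, Finset.mem_image,
    SimpleGraph.isNIndepSet_iff, Finset.card_eq_one]
  constructor
  · rintro ⟨-, a, rfl⟩; exact ⟨a, rfl⟩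
  · rintro ⟨a, rfl⟩; exact ⟨by simp, a, rfl⟩

lemma indepSum_eq_of_indepNum_le_three {V : Type*} [Fintype V] (G : SimpleGraph V)
    (hG : G.indepNum ≤ 3) (z : ℂ) :
    indepSum G z = 1 + Fintype.card V * z + indepCount G 2 * z ^ 2 + indepCount G 3 * z ^ 3 := by
  classical
  have hmap : ∀ s ∈ (Finset.univ.filter fun s : Finset V => G.IsIndepSet (s : Set V)),
      s.card ∈ Finset.range 4 := by
    intro s hs
    have := (Finset.mem_filter.1 hs).2.card_le_indepNum
    simp only [Finset.mem_range]; omega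
  have h0 : indepCount G 0 = 1 := by
    rw [indepCount, Finset.card_eq_one]
    refine ⟨∅, ?_⟩
    ext s
    simp only [Finset.mem_filter, Finset.mem_univ, true_and, Finset.mem_singleton,
      SimpleGraph.isNIndepSet_iff, Finset.card_eq_zero]
    exact ⟨fun h => h.2, fun h => by simp [h]⟩
  have hk : ∀ k, (∑ s ∈ (Finset.univ.filter fun s : Finset V =>
      G.IsIndepSet (s : Set V)).filter (fun s => s.card = k), z ^ s.card) = indepCount G k * z ^ k := by
    intro k
    rw [Finset.sum_congr rfl fun s hs => by rw [(Finset.mem_filter.1 hs).2], Finset.sum_const,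
      nsmul_eq_mul, Finset.filter_filter, indepCount]
    simp only [SimpleGraph.isNIndepSet_iff]
  rw [indepSum, ← Finset.sum_fiberwise_of_maps_to hmap, Finset.sum_congr rfl fun k _ => hk k]
  simp [Finset.sum_range_succ, h0, indepCount_one]

lemma indepSum_ne_zero_of_indepNum_le_three {V : Type*} [Fintype V] (G : SimpleGraph V)
    (hG : G.indepNum ≤ 3) {z : ℂ} (hz : 1 < (z⁻¹).re) : indepSum G z ≠ 0 := by
  rw [indepSum_eq_of_indepNum_le_three G hG]
  have hz0 : z ≠ 0 := fun h0 => by simp [h0] at hz; linarith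
  have h32 : (indepCount G 3 : ℝ) ≤ Fintype.card V * indepCount G 2 := by
    exact_mod_cast indepCount_succ_le G 2
  set n : ℝ := ((Fintype.card V : ℕ) : ℝ) with hn
  set p : ℝ := ((indepCount G 2 : ℕ) : ℝ) with hp
  set q : ℝ := ((indepCount G 3 : ℕ) : ℝ) with hq
  have hn0 : 0 ≤ n := Nat.cast_nonneg _
  have hp0 : 0 ≤ p := Nat.cast_nonneg _
  have hq0 : 0 ≤ q := Nat.cast_nonneg _
  -- These are the coefficients of z⁻³ i(G,z) in powers of s = 1/z - 1; c ≤ ab follows from q ≤ np.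
  have key := cubic_ne_zero (a := 3 + n) (b := 3 + 2 * n + p) (c := 1 + n + p + q)
    (by positivity) (by positivity) (by positivity) (by nlinarith [sq_nonneg n])
    (s := z⁻¹ - 1) (by simpa using hz)
  intro h0
  apply key
  have h1 : ((Fintype.card V : ℕ) : ℂ) = (n : ℂ) := by simp [hn]
  have h2 : ((indepCount G 2 : ℕ) : ℂ) = (p : ℂ) := by simp [hp]
  have h3 : ((indepCount G 3 : ℕ) : ℂ) = (q : ℂ) := by simp [hq]
  rw [h1, h2, h3] at h0
  have : (z⁻¹) ^ 3 * (1 + n * z + p * z ^ 2 + q * z ^ 3) = 0 := by rw [h0, mul_zero]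
  rw [← this]
  push_cast
  field_simp
  ring

/-! ### Claw-free graphs -/

open scoped ComplexOrder ComplexConjugate

open Classical in
lemma ClawFree.card_neighbors_le_two {V : Type*} [Fintype V] {G : SimpleGraph V}
    (hG : ClawFree G) {B : Finset V} (hB : G.IsIndepSet (B : Set V)) (w : V) :
    (B.filter (G.Adj w)).card ≤ 2 := by
  by_contra! h
  obtain ⟨f⟩ : Nonempty (Fin 3 ↪ (B.filter (G.Adj w))) :=
    Function.Embedding.nonempty_of_card_le
      (by rw [Fintype.card_coe, Fintype.card_fin]; exact h)
  have hfB : ∀ i, (f i : V) ∈ B := fun i => (Finset.mem_filter.1 (f i).2).1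
  have hfw : ∀ i, G.Adj w (f i) := fun i => (Finset.mem_filter.1 (f i).2).2
  have hinj : ∀ i j, (f i : V) = f j → i = j := fun i j hij => f.injective (Subtype.ext hij)
  refine hG ⟨⟨⟨Sum.elim (fun _ => w) (fun i => (f i : V)), ?_⟩, ?_⟩⟩
  · rintro (a | i) (b | j) hab
    · exact congrArg _ (Subsingleton.elim _ _)
    · exact absurd hab (hfw j).ne
    · exact absurd hab (hfw i).ne'
    · exact congrArg _ (hinj i j hab)
  · rintro (a | i) (b | j)
    · exact iff_of_false (fun h => h.ne rfl) (by simp)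
    · exact iff_of_true (hfw j) (by simp)
    · exact iff_of_true (hfw i).symm (by simp)
    · exact iff_of_false (fun hadj => hB (hfB i) (hfB j) hadj.ne hadj) (by simp)

open Classical in
/-- The two colour classes of a connected bipartite graph in which each vertex of the first class
has at most two neighbours have almost the same size. -/
lemma card_le_card_add_one {V : Type*} [Fintype V] {G : SimpleGraph V} {A B : Finset V}
    (hAB : Disjoint A B) (hA : G.IsIndepSet (A : Set V)) (hB : G.IsIndepSet (B : Set V))
    (hdeg : ∀ a ∈ A, (B.filter (G.Adj a)).card ≤ 2)
    (hconn : ∀ S ⊆ A ∪ B, S.Nonempty → (∀ u ∈ S, ∀ v ∈ A ∪ B, G.Adj u v → v ∈ S) → S = A ∪ B) :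
    B.card ≤ A.card + 1 := by
  rcases A.eq_empty_or_nonempty with rfl | ⟨a₀, ha₀⟩
  · rcases B.eq_empty_or_nonempty with rfl | ⟨b, hb⟩
    · simp
    · have := hconn {b} (by simpa using hb) (by simp) (by
        intro u hu v hv huv
        obtain rfl := Finset.mem_singleton.1 hu
        exact absurd huv (hB hb (by simpa using hv) huv.ne))
      rw [Finset.empty_union] at this
      simp [← this]
  · let N : Finset V → Finset V := fun S => S.biUnion fun a => B.filter (G.Adj a)
    let P : Finset V → Prop := fun S => S.Nonempty ∧ (N S).card ≤ S.card + 1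
    have hP₀ : P {a₀} := ⟨by simp, by simpa [N] using hdeg a₀ ha₀⟩
    -- A largest S with |N(S)| ≤ |S| + 1 will turn out to be closed under adjacency together with
    -- N(S), hence everything.
    obtain ⟨S, hS, hmax⟩ := (A.powerset.filter P).exists_max_image Finset.card
      ⟨{a₀}, by simpa using ⟨ha₀, hP₀⟩⟩
    obtain ⟨hSA, hSne, hScard⟩ : S ⊆ A ∧ P S := by simpa using hS
    have hNB : N S ⊆ B := Finset.biUnion_subset.2 fun a _ => Finset.filter_subset _ _
    have hall : S ∪ N S = A ∪ B := by
      refine hconn _ (Finset.union_subset_union hSA hNB) (hSne.mono Finset.subset_union_left) ?_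
      intro u hu v hv huv
      rcases Finset.mem_union.1 hu with hu | hu
      · rcases Finset.mem_union.1 hv with hv | hv
        · exact absurd huv (hA (hSA hu) hv huv.ne)
        · exact Finset.mem_union_right _
            (Finset.mem_biUnion.2 ⟨u, hu, Finset.mem_filter.2 ⟨hv, huv⟩⟩)
      · rcases Finset.mem_union.1 hv with hv | hv
        -- Since v already shares the neighbour u with S, adding it brings at most one new
        -- neighbour, against maximality.
        · by_contra hvS
          have hvS' : v ∉ S := fun h => hvS (Finset.mem_union_left _ h)
          have hmem : insert v S ∈ A.powerset.filter P := by
            simp only [Finset.mem_filter, Finset.mem_powerset]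
            refine ⟨Finset.insert_subset hv hSA, by simp, ?_⟩
            have hN : N (insert v S) = N S ∪ (B.filter (G.Adj v)).erase u := by
              simp only [N, Finset.biUnion_insert]
              ext x
              by_cases hx : x = u
              · subst hx; simpa using fun _ _ => by simpa [N] using hu
              · simp [hx, or_comm]
            have h1 := Finset.card_union_le (N S) ((B.filter (G.Adj v)).erase u)
            have h2 := hdeg v hv
            have h3 : u ∈ B.filter (G.Adj v) := Finset.mem_filter.2 ⟨hNB hu, huv.symm⟩
            rw [hN, Finset.card_insert_of_notMem hvS']
            rw [Finset.card_erase_of_mem h3] at h1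
            omega
          have := hmax _ hmem
          rw [Finset.card_insert_of_notMem hvS'] at this
          omega
        · exact absurd huv (hB (hNB hu) hv huv.ne)
    have hBN : B ⊆ N S := by
      intro b hb
      have : b ∈ S ∪ N S := hall ▸ Finset.mem_union_right _ hb
      refine (Finset.mem_union.1 this).resolve_left fun hbS => ?_
      exact Finset.disjoint_left.1 hAB (hSA hbS) hb
    calc B.card ≤ (N S).card := Finset.card_le_card hBN
      _ ≤ S.card + 1 := hScard
      _ ≤ A.card + 1 := by gcongr

open Classical in
/-- The weighted count of the partitions of `D` into two independent sets. -/
noncomputable def bipartitionSum {V : Type*} (G : SimpleGraph V) (D : Finset V) (z : ℂ) : ℂ :=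
  ∑ A ∈ D.powerset.filter (fun A : Finset V =>
    G.IsIndepSet (A : Set V) ∧ G.IsIndepSet ((D \ A : Finset V) : Set V)),
    z ^ A.card * conj z ^ (D \ A).card

open Classical in
lemma isIndepSet_union_iff {V : Type*} {G : SimpleGraph V} {A B : Finset V}
    (h : ∀ a ∈ A, ∀ b ∈ B, ¬ G.Adj a b) :
    G.IsIndepSet ((A ∪ B : Finset V) : Set V) ↔
      G.IsIndepSet (A : Set V) ∧ G.IsIndepSet (B : Set V) := by
  refine ⟨fun hAB => ⟨hAB.mono (by simp), hAB.mono (by simp)⟩, ?_⟩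
  rintro ⟨hA, hB⟩ u hu v hv huv
  simp only [Finset.coe_union, Set.mem_union, Finset.mem_coe] at hu hv
  rcases hu with hu | hu <;> rcases hv with hv | hv
  · exact hA hu hv huv
  · exact h u hu v hv
  · exact fun hadj => h v hv u hu hadj.symm
  · exact hB hu hv huv

open Classical in
lemma bipartitionSum_union {V : Type*} {G : SimpleGraph V} {K L : Finset V}
    (hKL : Disjoint K L) (h : ∀ a ∈ K, ∀ b ∈ L, ¬ G.Adj a b) (z : ℂ) :
    bipartitionSum G (K ∪ L) z = bipartitionSum G K z * bipartitionSum G L z := by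
  rw [bipartitionSum, bipartitionSum, bipartitionSum, Finset.sum_mul_sum, ← Finset.sum_product']
  symm
  have hd : ∀ {A B : Finset V}, A ⊆ K → B ⊆ L → (K ∪ L) \ (A ∪ B) = (K \ A) ∪ (L \ B) := by
    intro A B hA hB
    have h0 := Finset.disjoint_left.1 hKL
    ext x
    have := @hA x; have := @hB x; have := @h0 x
    simp only [Finset.mem_sdiff, Finset.mem_union]; tauto
  have hsub : ∀ {A B : Finset V}, A ⊆ K → B ⊆ L → ∀ a ∈ A, ∀ b ∈ B, ¬ G.Adj a b :=
    fun hA hB a ha b hb => h a (hA ha) b (hB hb)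
  refine Finset.sum_bij' (fun p _ => p.1 ∪ p.2) (fun A _ => (A ∩ K, A ∩ L)) ?_ ?_ ?_ ?_ ?_
  · rintro ⟨A, B⟩ hp
    simp only [Finset.mem_product, Finset.mem_filter, Finset.mem_powerset] at hp ⊢
    obtain ⟨⟨hA, hA1, hA2⟩, hB, hB1, hB2⟩ := hp
    exact ⟨Finset.union_subset_union hA hB, (isIndepSet_union_iff (hsub hA hB)).2 ⟨hA1, hB1⟩, by
      rw [hd hA hB]
      exact (isIndepSet_union_iff (hsub Finset.sdiff_subset Finset.sdiff_subset)).2 ⟨hA2, hB2⟩⟩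
  · intro A hA
    simp only [Finset.mem_product, Finset.mem_filter, Finset.mem_powerset] at hA ⊢
    obtain ⟨hA, hA1, hA2⟩ := hA
    refine ⟨⟨Finset.inter_subset_right, hA1.mono (by simp), hA2.mono ?_⟩,
      Finset.inter_subset_right, hA1.mono (by simp), hA2.mono ?_⟩ <;>
    · intro x; simp only [Finset.coe_sdiff, Finset.coe_inter, Finset.coe_union, Set.mem_sdiff,
        Set.mem_inter_iff, Set.mem_union]; tauto
  · rintro ⟨A, B⟩ hp
    simp only [Finset.mem_product, Finset.mem_filter, Finset.mem_powerset] at hp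
    have hA := hp.1.1
    have hB := hp.2.1
    have h0 := Finset.disjoint_left.1 hKL
    refine Prod.ext ?_ ?_ <;>
    · ext x
      have := @hA x; have := @hB x; have := @h0 x
      simp only [Finset.mem_inter, Finset.mem_union]; tauto
  · intro A hA
    simp only [Finset.mem_filter, Finset.mem_powerset] at hA
    rw [← Finset.inter_union_distrib_left, Finset.inter_eq_left.2 hA.1]
  · rintro ⟨A, B⟩ hp
    simp only [Finset.mem_product, Finset.mem_filter, Finset.mem_powerset] at hp
    have hA := hp.1.1
    have hB := hp.2.1
    simp only
    rw [hd hA hB, Finset.card_union_of_disjoint (hKL.mono hA hB), Finset.card_union_of_disjoint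
      (hKL.mono Finset.sdiff_subset Finset.sdiff_subset)]
    ring

/-- After extracting a power of |z|², what remains is 2 or 2 Re z. -/
lemma pow_mul_conj_pow_add_nonneg {z : ℂ} (hz : 0 ≤ z.re) {a b : ℕ} (hab : a ≤ b + 1)
    (hba : b ≤ a + 1) : 0 ≤ z ^ a * conj z ^ b + z ^ b * conj z ^ a := by
  have h1 : 0 ≤ z * conj z := by
    rw [Complex.mul_conj]; exact_mod_cast Complex.normSq_nonneg z
  have h2 : 0 ≤ z + conj z := by
    rw [Complex.add_conj]; exact_mod_cast by positivity
  rcases lt_trichotomy a b with h | rfl | h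
  · obtain rfl : b = a + 1 := by omega
    rw [show z ^ a * conj z ^ (a + 1) + z ^ (a + 1) * conj z ^ a =
      (z * conj z) ^ a * (z + conj z) by ring]
    exact mul_nonneg (pow_nonneg h1 _) h2
  · rw [← mul_pow]
    exact add_nonneg (pow_nonneg h1 _) (pow_nonneg h1 _)
  · obtain rfl : a = b + 1 := by omega
    rw [show z ^ (b + 1) * conj z ^ b + z ^ b * conj z ^ (b + 1) =
      (z * conj z) ^ b * (z + conj z) by ring]
    exact mul_nonneg (pow_nonneg h1 _) h2

open Classical in
-- A connected graph has at most one 2-colouring up to swapping, so the sum is empty or a pair of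
-- conjugate terms.
lemma ClawFree.bipartitionSum_nonneg_of_connected {V : Type*} [Fintype V]
    {G : SimpleGraph V} (hG : ClawFree G) {z : ℂ} (hz : 0 ≤ z.re) {K : Finset V}
    (hK : K.Nonempty)
    (hconn : ∀ S ⊆ K, S.Nonempty → (∀ u ∈ S, ∀ v ∈ K, G.Adj u v → v ∈ S) → S = K) :
    0 ≤ bipartitionSum G K z := by
  rw [bipartitionSum]
  rcases Finset.eq_empty_or_nonempty (K.powerset.filter (fun A : Finset V =>
    G.IsIndepSet (A : Set V) ∧ G.IsIndepSet ((K \ A : Finset V) : Set V))) with h | ⟨A₀, hA₀⟩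
  · rw [h, Finset.sum_empty]
  · simp only [Finset.mem_filter, Finset.mem_powerset] at hA₀
    obtain ⟨hA₀K, hA₀, hA₀'⟩ := hA₀
    have hset : K.powerset.filter (fun A : Finset V =>
        G.IsIndepSet (A : Set V) ∧ G.IsIndepSet ((K \ A : Finset V) : Set V)) =
        {A₀, K \ A₀} := by
      ext A
      simp only [Finset.mem_filter, Finset.mem_powerset, Finset.mem_insert, Finset.mem_singleton]
      constructor
      · rintro ⟨hAK, hA, hA'⟩
        -- The set where two colourings agree is closed under adjacency, so it is empty or all of K.
        have hclosed : ∀ u ∈ K.filter (fun x => x ∈ A ↔ x ∈ A₀), ∀ v ∈ K, G.Adj u v →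
            v ∈ K.filter (fun x => x ∈ A ↔ x ∈ A₀) := by
          intro u hu v hv huv
          obtain ⟨huK, hu⟩ := Finset.mem_filter.1 hu
          refine Finset.mem_filter.2 ⟨hv, ?_⟩
          have flip : ∀ {B : Finset V}, G.IsIndepSet (B : Set V) →
              G.IsIndepSet ((K \ B : Finset V) : Set V) → (v ∈ B ↔ u ∉ B) := by
            intro B hB hB'
            refine ⟨fun h1 h2 => hB h2 h1 huv.ne huv, fun h1 => ?_⟩
            by_contra h2
            exact hB' (Finset.mem_coe.2 (Finset.mem_sdiff.2 ⟨huK, h1⟩))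
              (Finset.mem_coe.2 (Finset.mem_sdiff.2 ⟨hv, h2⟩)) huv.ne huv
          rw [flip hA hA', flip hA₀ hA₀', hu]
        rcases (K.filter (fun x => x ∈ A ↔ x ∈ A₀)).eq_empty_or_nonempty with he | hne
        · right
          ext x
          have h1 := @hAK x
          have h2 : ¬ (x ∈ K ∧ (x ∈ A ↔ x ∈ A₀)) := fun h =>
            Finset.notMem_empty x (he ▸ Finset.mem_filter.2 h)
          simp only [Finset.mem_sdiff]; tauto
        · left
          have he := hconn _ (Finset.filter_subset _ _) hne hclosed
          ext x
          have h1 := @hAK x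
          have h2 := @hA₀K x
          have h3 : x ∈ K → (x ∈ A ↔ x ∈ A₀) := fun hx => by
            rw [← he] at hx; exact (Finset.mem_filter.1 hx).2
          tauto
      · rintro (rfl | rfl)
        · exact ⟨hA₀K, hA₀, hA₀'⟩
        · exact ⟨Finset.sdiff_subset, hA₀', by rwa [Finset.sdiff_sdiff_eq_self hA₀K]⟩
    have hne : A₀ ≠ K \ A₀ := by
      obtain ⟨x, hx⟩ := hK
      intro he
      have : x ∈ A₀ ↔ x ∈ K \ A₀ := by rw [← he]
      simp only [Finset.mem_sdiff] at this
      tauto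
    rw [hset, Finset.sum_pair hne, Finset.sdiff_sdiff_eq_self hA₀K]
    have hun : A₀ ∪ K \ A₀ = K := Finset.union_sdiff_of_subset hA₀K
    refine pow_mul_conj_pow_add_nonneg hz ?_ ?_
    · refine card_le_card_add_one Finset.sdiff_disjoint hA₀' hA₀
        (fun a _ => hG.card_neighbors_le_two hA₀ a) ?_
      rw [Finset.union_comm, hun]; exact hconn
    · refine card_le_card_add_one Finset.disjoint_sdiff hA₀ hA₀'
        (fun a _ => hG.card_neighbors_le_two hA₀' a) ?_
      rw [hun]; exact hconn

open Classical in
lemma ClawFree.bipartitionSum_nonneg {V : Type*} [Fintype V] {G : SimpleGraph V}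
    (hG : ClawFree G) {z : ℂ} (hz : 0 ≤ z.re) (D : Finset V) : 0 ≤ bipartitionSum G D z := by
  induction D using Finset.strongInduction with
  | H D ih =>
    by_cases hcon : ∀ S ⊆ D, S.Nonempty → (∀ u ∈ S, ∀ v ∈ D, G.Adj u v → v ∈ S) → S = D
    · rcases D.eq_empty_or_nonempty with rfl | hD
      · simp [bipartitionSum, Finset.filter_singleton]
      · exact hG.bipartitionSum_nonneg_of_connected hz hD hcon
    · push Not at hcon
      obtain ⟨S, hSD, hS, hcl, hne⟩ := hcon
      rw [← Finset.union_sdiff_of_subset hSD, bipartitionSum_union Finset.disjoint_sdiff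
        fun a ha b hb hadj => (Finset.mem_sdiff.1 hb).2 (hcl a ha b (Finset.mem_sdiff.1 hb).1 hadj)]
      exact mul_nonneg (ih S (hSD.ssubset_of_ne hne)) (ih _ (Finset.sdiff_ssubset hSD hS))

open Classical in
/-- The pairs of independent sets with given intersection and union contribute a nonnegative amount
to `|i(G, z)|²`. -/
lemma ClawFree.sum_fiber_nonneg {V : Type*} [Fintype V] {G : SimpleGraph V}
    (hG : ClawFree G) {z : ℂ} (hz : 0 ≤ z.re) (I : Finset (Finset V))
    (hI : ∀ s, s ∈ I ↔ G.IsIndepSet (s : Set V)) (C U : Finset V) :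
    0 ≤ ∑ p ∈ (I ×ˢ I).filter (fun p => (p.1 ∩ p.2, p.1 ∪ p.2) = (C, U)),
      z ^ p.1.card * conj z ^ p.2.card := by
  rcases Finset.eq_empty_or_nonempty
    ((I ×ˢ I).filter (fun p => (p.1 ∩ p.2, p.1 ∪ p.2) = (C, U))) with h | ⟨⟨A₀, B₀⟩, h₀⟩
  · rw [h, Finset.sum_empty]
  · simp only [Finset.mem_filter, Finset.mem_product, hI, Prod.mk.injEq] at h₀
    obtain ⟨⟨hA₀, hB₀⟩, hC, hU⟩ := h₀
    have hCind : G.IsIndepSet (C : Set V) := hA₀.mono (by simp [← hC])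
    have hCU : C ⊆ U := by
      rw [← hC, ← hU]; exact Finset.inter_subset_left.trans Finset.subset_union_left
    have hno : ∀ a ∈ C, ∀ b ∈ U, ¬ G.Adj a b := by
      intro a ha b hb hadj
      rw [← hC, Finset.mem_inter] at ha
      rw [← hU, Finset.mem_union] at hb
      rcases hb with hb | hb
      · exact hA₀ ha.1 hb hadj.ne hadj
      · exact hB₀ ha.2 hb hadj.ne hadj
    -- No edge joins C to U, so C can be added back to both halves of any bipartition of U \ C.
    have hsum : ∑ p ∈ (I ×ˢ I).filter (fun p => (p.1 ∩ p.2, p.1 ∪ p.2) = (C, U)),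
        z ^ p.1.card * conj z ^ p.2.card = (z * conj z) ^ C.card * bipartitionSum G (U \ C) z := by
      rw [bipartitionSum, Finset.mul_sum]
      have hB : ∀ {A B : Finset V}, A ∩ B = C → A ∪ B = U → (U \ C) \ (A \ C) = B \ C := by
        rintro A B rfl rfl
        ext x; simp only [Finset.mem_sdiff, Finset.mem_union, Finset.mem_inter]; tauto
      refine Finset.sum_bij' (fun p _ => p.1 \ C) (fun A _ => (C ∪ A, C ∪ ((U \ C) \ A)))
        ?_ ?_ ?_ ?_ ?_
      · rintro ⟨A, B⟩ hp
        simp only [Finset.mem_filter, Finset.mem_product, hI, Prod.mk.injEq,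
          Finset.mem_powerset] at hp ⊢
        obtain ⟨⟨hA, hB'⟩, h1, h2⟩ := hp
        refine ⟨Finset.sdiff_subset_sdiff (h2 ▸ Finset.subset_union_left) subset_rfl,
          hA.mono (by simp), ?_⟩
        rw [hB h1 h2]
        exact hB'.mono (by simp)
      · intro A hA
        simp only [Finset.mem_filter, Finset.mem_product, hI, Prod.mk.injEq,
          Finset.mem_powerset] at hA ⊢
        obtain ⟨hAU, hA1, hA2⟩ := hA
        refine ⟨⟨(isIndepSet_union_iff fun a ha b hb => hno a ha b
          (Finset.sdiff_subset (hAU hb))).2 ⟨hCind, hA1⟩,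
          (isIndepSet_union_iff fun a ha b hb => hno a ha b
          (Finset.sdiff_subset (Finset.sdiff_subset hb))).2 ⟨hCind, hA2⟩⟩, ?_, ?_⟩ <;>
        · ext x
          have h1 := @hAU x
          have h2 := @hCU x
          simp only [Finset.mem_sdiff, Finset.mem_union, Finset.mem_inter] at h1 ⊢
          tauto
      · rintro ⟨A, B⟩ hp
        simp only [Finset.mem_filter, Finset.mem_product, hI, Prod.mk.injEq] at hp
        obtain ⟨-, h1, h2⟩ := hp
        have hCA : C ⊆ A := h1 ▸ Finset.inter_subset_left
        have hCB : C ⊆ B := h1 ▸ Finset.inter_subset_right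
        simp only
        rw [hB h1 h2, Finset.union_sdiff_of_subset hCA, Finset.union_sdiff_of_subset hCB]
      · intro A hA
        simp only [Finset.mem_filter, Finset.mem_powerset] at hA
        exact Finset.union_sdiff_cancel_left
          (Finset.disjoint_sdiff.mono_right hA.1)
      · rintro ⟨A, B⟩ hp
        simp only [Finset.mem_filter, Finset.mem_product, hI, Prod.mk.injEq] at hp
        obtain ⟨-, h1, h2⟩ := hp
        have hCA : C ⊆ A := h1 ▸ Finset.inter_subset_left
        have hCB : C ⊆ B := h1 ▸ Finset.inter_subset_right
        simp only
        rw [hB h1 h2, ← Finset.card_sdiff_add_card_eq_card hCA,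
          ← Finset.card_sdiff_add_card_eq_card hCB]
        ring
    rw [hsum]
    refine mul_nonneg (pow_nonneg ?_ _) (hG.bipartitionSum_nonneg hz _)
    rw [Complex.mul_conj]; exact_mod_cast Complex.normSq_nonneg z

open Classical in
/-- The independence polynomial of a claw-free graph has no zeros in the closed right half-plane. -/
lemma ClawFree.indepSum_ne_zero {V : Type*} [Fintype V] {G : SimpleGraph V}
    (hG : ClawFree G) {z : ℂ} (hz : 0 ≤ z.re) : indepSum G z ≠ 0 := by
  have key : (1 : ℂ) ≤ indepSum G z * conj (indepSum G z) := by
    rw [indepSum, map_sum, Finset.sum_mul_sum, ← Finset.sum_product']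
    simp only [map_pow]
    set I := Finset.univ.filter (fun s : Finset V => G.IsIndepSet (s : Set V)) with hIdef
    have hI : ∀ s, s ∈ I ↔ G.IsIndepSet (s : Set V) := by simp [hIdef]
    rw [← Finset.sum_fiberwise (I ×ˢ I) (fun p => (p.1 ∩ p.2, p.1 ∪ p.2))]
    -- Only the group with empty intersection and union is kept; it is the single pair (∅, ∅).
    refine le_trans (le_of_eq ?_) (Finset.single_le_sum
      (fun q _ => hG.sum_fiber_nonneg hz I hI q.1 q.2)
      (Finset.mem_univ ((∅, ∅) : Finset V × Finset V)))
    have : (I ×ˢ I).filter (fun p => (p.1 ∩ p.2, p.1 ∪ p.2) = (∅, ∅)) = {(∅, ∅)} := by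
      ext ⟨A, B⟩
      simp only [Finset.mem_filter, Finset.mem_product, hI, Prod.mk.injEq, Finset.mem_singleton,
        Finset.union_eq_empty]
      constructor
      · exact fun h => h.2.2
      · rintro ⟨rfl, rfl⟩; simp
    rw [this, Finset.sum_singleton]
    simp
  intro h0
  rw [h0, zero_mul] at key
  exact absurd key (by simp [Complex.le_def])

end IndepStability

theorem mainTheorem10 {V : Type*} [Finite V] (G : SimpleGraph V)
    (hG : IndepStability.ClawFree G ∨
      (∃ n : ℕ, Nonempty (G ≃g completeBipartiteGraph (Fin 1) (Fin n))) ∨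
      G.indepNum ≤ 3)
    (k : ℕ) (hk : 1 ≤ k) :
    IndepStability.GraphStable (IndepStability.kStar G k) := by
  have := Fintype.ofFinite V
  refine IndepStability.graphStable_kStar G (fun z hz => ?_) k hk
  rw [IndepStability.aeval_indepPoly]
  rcases hG with hG | ⟨n, ⟨e⟩⟩ | hG
  · exact hG.indepSum_ne_zero (IndepStability.re_pos_and_norm_lt_one hz).1.le
  · rw [IndepStability.indepSum_congr e]
    exact IndepStability.indepSum_star_ne_zero n hz
  · exact IndepStability.indepSum_ne_zero_of_indepNum_le_three G hG hz
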